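/- Let $\mathcal F$ be a filter on $\omega$, i.e. a family of infinite subsets of $\omega$ that contains all cofinite sets and is closed under finite intersections and under supersets. Mathias forcing $\mathbb M_{\mathcal F}$ consists of the pairs $\langle s,F\rangle$ with $s\subset\omega$ finite, $F\in\mathcal F$, and every element of $s$ smaller than every element of $F$; a condition $\langle s,F\rangle$ is stronger than $\langle t,G\rangle$ if $F\subset G$, $s$ is an end-extension of $t$, and $s\setminus t\subset G$. Then $\mathbb M_{\mathcal F}$ adds no dominating reals (that is, no condition forces that there is $x\in\omega^\omega$ in the generic extension such that for every ground model $a\in\omega^\omega$ one has $a(n)\le x(n)$ for all but finitely many $n$) if and only if $\mathcal F$, as a subspace of $\mathcal P(\omega)\cong 2^\omega$, has the Menger covering property: for every sequence $\langle\mathcal U_n:n\in\omega\rangle$ of open covers of $\mathcal F$ there are finite $\mathcal V_n\subset\mathcal U_n$ such that $\bigcup_{n\in\omega}\bigcup\mathcal V_n=\mathcal F$. -/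

import Mathlib

/-- The Menger covering property of a topological space: from any sequence of open covers one can
choose finite subfamilies whose unions cover the space. -/
def MengerProperty (X : Type*) [TopologicalSpace X] : Prop :=
  ∀ U : ℕ → Set (Set X),
    (∀ n, (∀ u ∈ U n, IsOpen u) ∧ ⋃₀ U n = Set.univ) →
    ∃ V : ℕ → Set (Set X),
      (∀ n, V n ⊆ U n ∧ (V n).Finite) ∧ ⋃ n, ⋃₀ V n = Set.univ

/-- A filter on `ℕ` viewed as a subset of the Cantor space `ℕ → Bool` (discrete `Bool`, product
topology), via characteristic functions. -/
def filterCantor (F : Filter ℕ) : Set (ℕ → Bool) :=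
  {x | {n | x n = true} ∈ F}

/-- Conditions of the Mathias forcing associated with `F`: pairs of a finite `stem` and a set `side`
in `F` with every element of the stem below every element of `side`. -/
@[ext]
structure MathiasForcing (F : Filter ℕ) where
  stem : Finset ℕ
  side : Set ℕ
  side_mem : side ∈ F
  stem_lt_side : ∀ i ∈ stem, ∀ j ∈ side, i < j

/-- `p ≤ q` means that `p` is stronger than `q`: the side set shrinks, the stem of `p` end-extends
that of `q`, and the new elements of the stem belong to the side set of `q`. -/
instance (F : Filter ℕ) : LE (MathiasForcing F) where
  le p q := p.side ⊆ q.side ∧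
    (q.stem ⊆ p.stem ∧ ∀ i ∈ p.stem, i ∉ q.stem → ∀ j ∈ q.stem, j < i) ∧
    ∀ i ∈ p.stem, i ∉ q.stem → i ∈ q.side

instance (F : Filter ℕ) : PartialOrder (MathiasForcing F) where
  le_refl p := ⟨subset_rfl, ⟨subset_rfl, fun _ hi hi' => absurd hi hi'⟩,
    fun _ hi hi' => absurd hi hi'⟩
  le_trans p q r hpq hqr := by
    obtain ⟨h1, ⟨h2, h3⟩, h4⟩ := hpq
    obtain ⟨k1, ⟨k2, k3⟩, k4⟩ := hqr
    refine ⟨h1.trans k1, ⟨k2.trans h2, fun i hi hir j hj => ?_⟩, fun i hi hir => ?_⟩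
    · by_cases hq : i ∈ q.stem
      · exact k3 i hq hir j hj
      · exact h3 i hi hq j (k2 hj)
    · by_cases hq : i ∈ q.stem
      · exact k4 i hq hir
      · exact k1 (h4 i hi hq)
  le_antisymm p q hpq hqp :=
    MathiasForcing.ext (hqp.2.1.1.antisymm hpq.2.1.1) (hpq.1.antisymm hqp.1)

/-- A (nice) `P`-name for a subset of `ℕ × ℕ`: a set of triples `(n, m, s)`, where `s : P` puts the
pair `(n, m)` into the relation. For a generic filter `G`, the name is evaluated as
`{(n, m) | ∃ s ∈ G, (n, m, s) ∈ τ}`. Every subset of `ℕ × ℕ` in a generic extension by `P` is the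
evaluation of such a name. -/
abbrev RelName (P : Type*) := Set (ℕ × ℕ × P)

namespace RelName

variable {P : Type*} [Preorder P]

/-- `p ⊩ (n, m) ∈ τ`: the conditions lying below some `s` with `(n, m, s) ∈ τ` are dense
below `p`. -/
def Forces (p : P) (τ : RelName P) (n m : ℕ) : Prop :=
  ∀ q ≤ p, ∃ r ≤ q, ∃ s, r ≤ s ∧ (n, m, s) ∈ τ

/-- `p ⊩ τ` is (the graph of) a function from `ℕ` to `ℕ`. -/
def ForcesReal (p : P) (τ : RelName P) : Prop :=
  (∀ n, ∀ q ≤ p, ∃ r ≤ q, ∃ m, Forces r τ n m) ∧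
  (∀ n m m', ∀ q ≤ p, Forces q τ n m → Forces q τ n m' → m = m')

/-- For `τ` a name of a function and `a` in the ground model:
`p ⊩ a n ≤ τ n` for all but finitely many `n`. -/
def ForcesEventuallyGe (p : P) (τ : RelName P) (a : ℕ → ℕ) : Prop :=
  ∀ q ≤ p, ∃ r ≤ q, ∃ k, ∀ n ≥ k, ∀ s ≤ r, ∀ m, Forces s τ n m → a n ≤ m

/-- `p ⊩ τ` is a dominating real over the ground model. -/
def ForcesDominating (p : P) (τ : RelName P) : Prop :=
  ForcesReal p τ ∧ ∀ a : ℕ → ℕ, ForcesEventuallyGe p τ a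

end RelName

/-- The forcing notion `P` adds no dominating reals: no condition forces any name to be a dominating
real over the ground model; that is, no generic extension by `P` contains a dominating real. -/
def AddsNoDominatingReal (P : Type*) [Preorder P] : Prop :=
  ∀ (p : P) (τ : RelName P), ¬ RelName.ForcesDominating p τ

open Set Topology

/-- Every member of `F` includes a member of `X`. -/
def IsFinsetPositive (F : Filter ℕ) (X : Set (Finset ℕ)) : Prop :=
  ∀ A ∈ F, ∃ s ∈ X, (s : Set ℕ) ⊆ A

/-- The Menger property of `F` with respect to covers by upward closed basic open sets. -/
def FinsetMenger (F : Filter ℕ) : Prop :=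
  ∀ X : ℕ → Set (Finset ℕ), (∀ n, IsFinsetPositive F (X n)) →
    ∃ Y : ℕ → Set (Finset ℕ), (∀ n, Y n ⊆ X n ∧ (Y n).Finite) ∧ IsFinsetPositive F (⋃ n, Y n)

/-! ### Topology: covers of the filter and finite sets -/

/-- The points of the Cantor space whose support includes `A`. -/
def cantorCone (A : Set ℕ) : Set (ℕ → Bool) := {x | ∀ i ∈ A, x i = true}

lemma isClosed_cantorCone (A : Set ℕ) : IsClosed (cantorCone A) := by
  have h : cantorCone A = ⋂ i ∈ A, {x | x i = true} := by
    ext x; simp [cantorCone]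
  rw [h]
  exact isClosed_biInter fun i _ => isClosed_eq (continuous_apply i) continuous_const

lemma isOpen_cantorCone (s : Finset ℕ) : IsOpen (cantorCone s) := by
  have h : cantorCone s = ⋂ i ∈ s, {x | x i = true} := by
    ext x; simp [cantorCone]
  rw [h]
  exact isOpen_biInter_finset fun i _ =>
    (isOpen_discrete {true}).preimage (continuous_apply (A := fun _ : ℕ => Bool) i)

lemma cantorCone_subset_filterCantor {F : Filter ℕ} {A : Set ℕ} (hA : A ∈ F) :
    cantorCone A ⊆ filterCantor F :=
  fun _ hx => Filter.mem_of_superset hA hx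

/-- By compactness: the cone of `A` is the decreasing intersection of the compact cones of `A ∩ Iio
n`, so one of these already lies in `O`. -/
lemma exists_finset_cantorCone_subset {A : Set ℕ} {O : Set (ℕ → Bool)} (hO : IsOpen O)
    (hAO : cantorCone A ⊆ O) : ∃ s : Finset ℕ, (s : Set ℕ) ⊆ A ∧ cantorCone s ⊆ O := by
  classical
  obtain ⟨n, hn⟩ := exists_subset_nhds_of_isCompact'
    (V := fun n => cantorCone (A ∩ Iio n))
    (directed_of_isDirected_le fun m n hmn x hx i hi =>
      hx i ⟨hi.1, lt_of_lt_of_le hi.2 hmn⟩)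
    (fun n => (isClosed_cantorCone _).isCompact) (fun n => isClosed_cantorCone _)
    (U := O) (fun x hx => hO.mem_nhds (hAO fun i hi =>
      mem_iInter.1 hx (i + 1) i ⟨hi, Nat.lt_succ_self i⟩))
  have hfin : (A ∩ Iio n).Finite := (finite_Iio n).inter_of_right A
  refine ⟨hfin.toFinset, by simp, by simpa using hn⟩

lemma finsetMenger_of_mengerProperty {F : Filter ℕ} (h : MengerProperty (filterCantor F)) :
    FinsetMenger F := by
  classical
  intro X hX
  obtain ⟨V, hV, hcov⟩ := h
    (fun n => (fun s : Finset ℕ => ((↑) : filterCantor F → ℕ → Bool) ⁻¹' cantorCone s) '' X n) (by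
      refine fun n => ⟨?_, eq_univ_of_forall fun x => ?_⟩
      · rintro _ ⟨s, -, rfl⟩
        exact (isOpen_cantorCone s).preimage continuous_subtype_val
      · obtain ⟨s, hs, hsx⟩ := hX n _ x.2
        exact ⟨_, mem_image_of_mem _ hs, hsx⟩)
  choose Y hYX hYfin hYV using fun n =>
    exists_subset_image_finite_and.1 ⟨V n, (hV n).1, (hV n).2, rfl⟩
  refine ⟨Y, fun n => ⟨hYX n, hYfin n⟩, fun A hA => ?_⟩
  let x : filterCantor F := ⟨fun i => decide (i ∈ A), by simpa [filterCantor] using hA⟩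
  obtain ⟨n, u, hu, hxu⟩ : ∃ n, ∃ u ∈ V n, x ∈ u := by
    have := hcov.ge (mem_univ x)
    simpa using this
  rw [hYV n] at hu
  obtain ⟨s, hs, rfl⟩ := hu
  exact ⟨s, mem_iUnion.2 ⟨n, hs⟩, fun i hi => by simpa [x] using hxu i hi⟩

lemma exists_finset_forall_mem_sUnion {F : Filter ℕ} {U : Set (Set (filterCantor F))}
    (hU : ∀ u ∈ U, IsOpen u) (hcov : ⋃₀ U = univ) {A : Set ℕ} (hA : A ∈ F) :
    ∃ s : Finset ℕ, (s : Set ℕ) ⊆ A ∧ ∃ V ⊆ U, V.Finite ∧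
      ∀ x : filterCantor F, (x : ℕ → Bool) ∈ cantorCone s → x ∈ ⋃₀ V := by
  have hK : IsCompact (((↑) : filterCantor F → ℕ → Bool) ⁻¹' cantorCone A) := by
    rw [Subtype.isCompact_iff, Subtype.image_preimage_coe,
      inter_eq_self_of_subset_right (cantorCone_subset_filterCantor hA)]
    exact (isClosed_cantorCone A).isCompact
  obtain ⟨V, hVU, hVfin, hV⟩ := hK.elim_finite_subcover_image (c := id) hU
    (by simp [← sUnion_eq_biUnion, hcov])
  simp only [id, ← sUnion_eq_biUnion] at hV
  obtain ⟨O, hO, hOV⟩ := isOpen_induced_iff.1 (isOpen_sUnion fun u hu => hU u (hVU hu))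
  rw [← hOV] at hV
  obtain ⟨s, hsA, hs⟩ := exists_finset_cantorCone_subset hO (A := A) fun x hx =>
    @hV ⟨x, cantorCone_subset_filterCantor hA hx⟩ hx
  exact ⟨s, hsA, V, hVU, hVfin, fun x hx => hOV ▸ hs hx⟩

lemma mengerProperty_of_finsetMenger {F : Filter ℕ} (h : FinsetMenger F) :
    MengerProperty (filterCantor F) := by
  intro U hU
  obtain ⟨Y, hY, hpos⟩ := h (fun n => {s | ∃ V ⊆ U n, V.Finite ∧
      ∀ x : filterCantor F, (x : ℕ → Bool) ∈ cantorCone s → x ∈ ⋃₀ V}) (fun n A hA => by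
    obtain ⟨s, hsA, hs⟩ := exists_finset_forall_mem_sUnion (hU n).1 (hU n).2 hA
    exact ⟨s, hs, hsA⟩)
  choose V hVU hVfin hV using fun n (s : Y n) => (hY n).1 s.2
  refine ⟨fun n => ⋃ s : Y n, V n s, fun n => ⟨iUnion_subset (hVU n), ?_⟩,
    eq_univ_of_forall fun x => ?_⟩
  · have := (hY n).2.to_subtype
    exact finite_iUnion (hVfin n)
  · obtain ⟨s, hs, hsx⟩ := hpos _ x.2
    obtain ⟨n, hn⟩ := mem_iUnion.1 hs
    obtain ⟨u, hu, hxu⟩ := hV n ⟨s, hn⟩ x hsx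
    exact mem_iUnion.2 ⟨n, u, mem_iUnion.2 ⟨_, hu⟩, hxu⟩

/-! ### Forcing: Menger selections defeat dominating names -/

lemma RelName.Forces.mono {P : Type*} [Preorder P] {p q : P} {τ : RelName P} {n m : ℕ}
    (h : Forces p τ n m) (hqp : q ≤ p) : Forces q τ n m :=
  fun r hr => h r (hr.trans hqp)

namespace MathiasForcing

variable {F : Filter ℕ}

/-- Shrink the side set of a condition. -/
def shrink (p : MathiasForcing F) (A : Set ℕ) (hA : A ∈ F) : MathiasForcing F where
  stem := p.stem
  side := p.side ∩ A
  side_mem := Filter.inter_mem p.side_mem hA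
  stem_lt_side i hi j hj := p.stem_lt_side i hi j hj.1

lemma shrink_le (p : MathiasForcing F) (A : Set ℕ) (hA : A ∈ F) : p.shrink A hA ≤ p :=
  ⟨inter_subset_left, ⟨subset_rfl, fun _ hi hi' => absurd hi hi'⟩, fun _ hi hi' => absurd hi hi'⟩

lemma Ioi_mem (hcof : F ≤ Filter.cofinite) (k : ℕ) : Ioi k ∈ F :=
  hcof (by rw [Filter.mem_cofinite, compl_Ioi]; exact finite_Iic k)

lemma Ici_mem (hcof : F ≤ Filter.cofinite) (k : ℕ) : Ici k ∈ F :=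
  Filter.mem_of_superset (Ioi_mem hcof k) Ioi_subset_Ici_self

/-- Move a finite part of the side set of a condition into its stem. -/
def extend (hcof : F ≤ Filter.cofinite) (p : MathiasForcing F) (u : Finset ℕ) :
    MathiasForcing F where
  stem := p.stem ∪ u
  side := p.side ∩ Ioi (u.sup id)
  side_mem := Filter.inter_mem p.side_mem (Ioi_mem hcof _)
  stem_lt_side i hi j hj := by
    rcases Finset.mem_union.1 hi with hi | hi
    · exact p.stem_lt_side i hi j hj.1
    · exact (Finset.le_sup (f := id) hi).trans_lt hj.2

lemma extend_le (hcof : F ≤ Filter.cofinite) (p : MathiasForcing F) {u : Finset ℕ}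
    (hu : (u : Set ℕ) ⊆ p.side) : p.extend hcof u ≤ p := by
  have h : ∀ i ∈ (p.extend hcof u).stem, i ∉ p.stem → i ∈ p.side := fun i hi hip =>
    hu ((Finset.mem_union.1 hi).resolve_left hip)
  exact ⟨inter_subset_left, ⟨Finset.subset_union_left, fun i hi hip j hj =>
    p.stem_lt_side j hj i (h i hi hip)⟩, h⟩

/-- The finite sets `u` above `s` such that a condition with stem `s ∪ u` decides `τ n`. -/
def decidingSets (τ : RelName (MathiasForcing F)) (s : Finset ℕ) (n : ℕ) : Set (Finset ℕ) :=
  {u | (∀ i ∈ s, ∀ j ∈ u, i < j) ∧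
    ∃ r : MathiasForcing F, r.stem = s ∪ u ∧ ∃ m, RelName.Forces r τ n m}

lemma isFinsetPositive_decidingSets {τ : RelName (MathiasForcing F)} {p q : MathiasForcing F}
    (hτ : RelName.ForcesReal p τ) (hqp : q ≤ p) (n : ℕ) :
    IsFinsetPositive F (decidingSets τ q.stem n) := by
  intro A hA
  obtain ⟨r, hr, m, hm⟩ := hτ.1 n (q.shrink A hA) ((q.shrink_le A hA).trans hqp)
  obtain ⟨-, ⟨hsub, hlt⟩, hside⟩ := hr
  refine ⟨r.stem \ q.stem, ⟨fun i hi j hj => ?_, r, ?_, m, hm⟩, fun i hi => ?_⟩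
  · rw [Finset.mem_sdiff] at hj
    exact hlt j hj.1 hj.2 i hi
  · exact (Finset.union_sdiff_of_subset hsub).symm
  · rw [Finset.mem_coe, Finset.mem_sdiff] at hi
    exact (hside i hi.1 hi.2).2

/-- Conditions with the same stem are compatible: intersecting the side of `r` with that of `q`
gives a condition below both `r` and `q`. -/
lemma exists_le_forces {τ : RelName (MathiasForcing F)} {q : MathiasForcing F} {n m : ℕ}
    {u : Finset ℕ} (huq : (u : Set ℕ) ⊆ q.side) {r : MathiasForcing F} (hr : r.stem = q.stem ∪ u)
    (hm : RelName.Forces r τ n m) : ∃ r' ≤ q, RelName.Forces r' τ n m := by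
  have h : ∀ i ∈ r.stem, i ∉ q.stem → i ∈ q.side := fun i hi hiq =>
    huq ((Finset.mem_union.1 (hr ▸ hi)).resolve_left hiq)
  exact ⟨r.shrink q.side q.side_mem, ⟨inter_subset_right,
    ⟨hr.symm ▸ Finset.subset_union_left, fun i hi hiq j hj =>
      q.stem_lt_side j hj i (h i hi hiq)⟩, h⟩, hm.mono (r.shrink_le _ _)⟩

theorem addsNoDominatingReal_of_finsetMenger (h : FinsetMenger F) :
    AddsNoDominatingReal (MathiasForcing F) := by
  rintro p τ ⟨hreal, hdom⟩
  have key : ∀ (s : Finset ℕ) (N : ℕ), ∃ Y : ℕ → Set (Finset ℕ),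
      (∀ n, Y n ⊆ decidingSets τ s (N + n) ∧ (Y n).Finite) ∧
      ((∀ n, IsFinsetPositive F (decidingSets τ s n)) → IsFinsetPositive F (⋃ n, Y n)) := by
    intro s N
    by_cases hs : ∀ n, IsFinsetPositive F (decidingSets τ s n)
    · obtain ⟨Y, hY, hpos⟩ := h (fun n => decidingSets τ s (N + n)) fun n => hs _
      exact ⟨Y, hY, fun _ => hpos⟩
    · exact ⟨fun _ => ∅, fun n => ⟨empty_subset _, finite_empty⟩, fun hs' => absurd hs' hs⟩
  choose Y hY hpos using key
  choose hgt r hr v hv using fun s N n (u : Y s N n) => (hY s N n).1 u.2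
  have hbdd : ∀ s N n, ∃ b, ∀ u : Y s N n, v s N n u < b := by
    intro s N n
    have := (hY s N n).2.to_subtype
    obtain ⟨b, hb⟩ := (finite_range (v s N n)).bddAbove
    exact ⟨b + 1, fun u => Nat.lt_succ_of_le (hb (mem_range_self u))⟩
  choose b hb using hbdd
  -- Diagonalise: at `l`, take the maximum over all stems within `[0, l]` and all starting points `N
  -- ≤ l`, as `q` and `k` are not yet known.
  obtain ⟨q, hqp, k, hk⟩ := hdom (fun l =>
    (Finset.range (l + 1)).powerset.sup fun s => (Finset.range (l + 1)).sup fun N =>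
      b s N (l - N)) p le_rfl
  -- Starting at `N` puts every index `N + n` beyond `k` and makes `q.stem` one of the stems counted
  -- there.
  set N := max k (q.stem.sup id)
  obtain ⟨u, hu, huq⟩ :=
    hpos q.stem N (isFinsetPositive_decidingSets hreal hqp) q.side q.side_mem
  obtain ⟨n, hn⟩ := mem_iUnion.1 hu
  obtain ⟨r', hr', hm⟩ := exists_le_forces huq (hr q.stem N n ⟨u, hn⟩) (hv q.stem N n ⟨u, hn⟩)
  have h1 := hk (N + n) ((le_max_left _ _).trans (Nat.le_add_right _ _)) r' hr' _ hm
  have h2 : q.stem ∈ (Finset.range (N + n + 1)).powerset :=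
    Finset.mem_powerset.2 fun i hi => Finset.mem_range.2 (Nat.lt_succ_of_le
      (((Finset.le_sup (f := id) hi).trans (le_max_right k _)).trans (Nat.le_add_right _ _)))
  have h3 : N ∈ Finset.range (N + n + 1) := Finset.mem_range.2 (by omega)
  have h4 := (Finset.le_sup (f := fun N' => b q.stem N' (N + n - N')) h3).trans
    (Finset.le_sup (f := fun s => (Finset.range (N + n + 1)).sup fun N' => b s N' (N + n - N')) h2)
  have h5 := hb q.stem N n ⟨u, hn⟩
  simp only [Nat.add_sub_cancel_left] at h4
  exact absurd (h4.trans h1) (not_le.2 h5)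

/-! ### The hitting function of the generic set -/

/-- `HitsBefore X t n k`: the part of `t` in `[n, k)` includes a member of `X n`. -/
def HitsBefore (X : ℕ → Set (Finset ℕ)) (t : Finset ℕ) (n k : ℕ) : Prop :=
  ∃ s ∈ X n, s ⊆ t ∧ ∀ i ∈ s, n ≤ i ∧ i < k

lemma HitsBefore.of_le {X : ℕ → Set (Finset ℕ)} {p q : MathiasForcing F} {n k : ℕ}
    (h : HitsBefore X q.stem n k) (hpq : p ≤ q) : HitsBefore X p.stem n k := by
  obtain ⟨s, hs, hsq, hsn⟩ := h
  exact ⟨s, hs, hsq.trans hpq.2.1.1, hsn⟩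

/-- The name of the function sending `n` to the least `k` such that the part of the generic set
in `[n, k)` includes a member of `X n`. -/
def hittingName (F : Filter ℕ) (X : ℕ → Set (Finset ℕ)) : RelName (MathiasForcing F) :=
  {x | IsLeast {k | HitsBefore X x.2.2.stem x.1 k} x.2.1}

/-- New stem elements exceed all old ones. An earlier hit using a new element would therefore end
after the whole old witness, which would then itself give an earlier hit in the old stem. -/
lemma isLeast_hitsBefore_of_le {X : ℕ → Set (Finset ℕ)} {p q : MathiasForcing F} {n k : ℕ}
    (h : IsLeast {k | HitsBefore X q.stem n k} k) (hpq : p ≤ q) :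
    IsLeast {k | HitsBefore X p.stem n k} k := by
  refine ⟨h.1.of_le hpq, fun l hl => ?_⟩
  by_contra! hlk
  obtain ⟨s, hs, hsp, hsn⟩ := hl
  by_cases hsq : s ⊆ q.stem
  · exact absurd (h.2 ⟨s, hs, hsq, hsn⟩) (not_le.2 hlk)
  · obtain ⟨i, his, hiq⟩ := Finset.not_subset.1 hsq
    obtain ⟨t, ht, htq, htn⟩ := h.1
    refine absurd (h.2 ⟨t, ht, htq, fun j hj => ⟨(htn j hj).1, ?_⟩⟩) (not_le.2 hlk)
    exact (hpq.2.1.2 i (hsp his) hiq j (htq hj)).trans (hsn i his).2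

lemma forces_hittingName {X : ℕ → Set (Finset ℕ)} {p : MathiasForcing F} {n k : ℕ}
    (h : IsLeast {k | HitsBefore X p.stem n k} k) :
    RelName.Forces p (hittingName F X) n k :=
  fun q hq => ⟨q, le_rfl, p, hq, h⟩

lemma exists_isLeast_of_forces {X : ℕ → Set (Finset ℕ)} {p : MathiasForcing F} {n k : ℕ}
    (h : RelName.Forces p (hittingName F X) n k) :
    ∃ q ≤ p, IsLeast {k | HitsBefore X q.stem n k} k := by
  obtain ⟨r, hr, s, hrs, hs⟩ := h p le_rfl
  exact ⟨r, hr, isLeast_hitsBefore_of_le hs hrs⟩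

lemma forcesReal_hittingName (hcof : F ≤ Filter.cofinite) {X : ℕ → Set (Finset ℕ)}
    (hX : ∀ n, IsFinsetPositive F (X n)) (p : MathiasForcing F) :
    RelName.ForcesReal p (hittingName F X) := by
  refine ⟨fun n q _ => ?_, fun n m m' q _ hm hm' => ?_⟩
  · obtain ⟨s, hs, hsq⟩ := hX n (q.side ∩ Ici n) (Filter.inter_mem q.side_mem (Ici_mem hcof n))
    have hne : {k | HitsBefore X (q.extend hcof s).stem n k}.Nonempty :=
      ⟨s.sup id + 1, s, hs, Finset.subset_union_right, fun i hi =>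
        ⟨(hsq hi).2, Nat.lt_succ_of_le (Finset.le_sup (f := id) hi)⟩⟩
    exact ⟨_, q.extend_le hcof (hsq.trans inter_subset_left), _,
      forces_hittingName ⟨Nat.sInf_mem hne, fun _ hk => Nat.sInf_le hk⟩⟩
  · obtain ⟨r, hr, hleast⟩ := exists_isLeast_of_forces hm
    obtain ⟨r', hr', hleast'⟩ := exists_isLeast_of_forces (hm'.mono hr)
    exact (isLeast_hitsBefore_of_le hleast hr').unique hleast'

theorem finsetMenger_of_addsNoDominatingReal (hcof : F ≤ Filter.cofinite)
    (h : AddsNoDominatingReal (MathiasForcing F)) : FinsetMenger F := by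
  intro X hX
  by_contra! hno
  let p : MathiasForcing F := ⟨∅, univ, Filter.univ_mem, by simp⟩
  refine h p (hittingName F X) ⟨forcesReal_hittingName hcof hX p, fun a q _ => ?_⟩
  have hfin : ∀ n, {s ∈ X n | s ⊆ Finset.range (a n)}.Finite := fun n =>
    (Finset.range (a n)).powerset.finite_toSet.subset fun s hs =>
      Finset.mem_coe.2 (Finset.mem_powerset.2 hs.2)
  -- If `a` bounded the hitting function infinitely often, hits would come from these finite
  -- selections; the set `A` avoids them all.
  have hneg := hno (fun n => {s ∈ X n | s ⊆ Finset.range (a n)})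
    fun n => ⟨sep_subset _ _, hfin n⟩
  simp only [IsFinsetPositive, not_forall, not_exists, not_and] at hneg
  obtain ⟨A, hA, hAY⟩ := hneg
  -- From this index on, elements of a hit are at least `n`, hence outside `q.stem`, so they must
  -- come from `A`.
  refine ⟨q.shrink A hA, q.shrink_le A hA, q.stem.sup id + 1, fun n hn s hs m hm => ?_⟩
  obtain ⟨r, hr, ⟨t, ht, htr, htn⟩, -⟩ := exists_isLeast_of_forces hm
  by_contra! hma
  refine hAY t (mem_iUnion.2 ⟨n, ht, fun i hi => Finset.mem_range.2 ((htn i hi).2.trans hma)⟩)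
    fun i hi => ?_
  refine ((hr.trans hs).2.2 i (htr hi) fun hiq => ?_).2
  have h1 : i ≤ q.stem.sup id := Finset.le_sup (f := id) hiq
  have h2 := (htn i hi).1
  omega

end MathiasForcing

theorem theorem1p1 (F : Filter ℕ) (hF : F.NeBot) (hcof : F ≤ Filter.cofinite) :
    AddsNoDominatingReal (MathiasForcing F) ↔ MengerProperty (filterCantor F) :=
  ⟨fun h => mengerProperty_of_finsetMenger
      (MathiasForcing.finsetMenger_of_addsNoDominatingReal hcof h),
    fun h => MathiasForcing.addsNoDominatingReal_of_finsetMenger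
      (finsetMenger_of_mengerProperty h)⟩
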